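/- A matrix multiplication game (MMG) is given by a finite set $\mathscr{A}$ of $M\times N$-matrices and a finite set $\mathscr{E}$ of $N\times M$-matrices ($M,N\ge 1$). At turn $i=1,2,\dots$ Adam writes a matrix $A_i\in\mathscr{A}$ and then Eve writes a matrix $E_i\in\mathscr{E}$. A strategy of Adam is a function $\sigma:(\mathscr{A}\cdot\mathscr{E})^*\to\mathscr{A}$ and a strategy of Eve is a function $\tau:(\mathscr{A}\cdot\mathscr{E})^*\cdot\mathscr{A}\to\mathscr{E}$, both giving the next move as a function of the history. The unique play $A_1E_1A_2E_2\cdots$ compatible with $\sigma$ and $\tau$ has payoff $$P(\sigma,\tau)=\limsup_{k\to\infty}\Bigl\|\prod_{i=1}^k A_iE_i\Bigr\|^{1/k},\qquad \|B\|=\sum_{i,j}|B_{ij}|.$$ The game is determined with value $V\in\mathbb{R}$ if there is a strategy $\sigma_0$ of Adam with $P(\sigma_0,\tau)\le V$ for all strategies $\tau$ of Eve, and a strategy $\tau_0$ of Eve with $P(\sigma,\tau_0)\ge V$ for all strategies $\sigma$ of Adam. Theorem. Consider MMGs with finite sets of integer matrices, given to an algorithm by explicit lists of the matrices. 1. The value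 of a determined such MMG is not computable from the matrices: there is no algorithm (partial recursive function) that, for every determined such MMG with value $V$ and every $n\in\mathbb{N}$, halts on input $(\mathscr{A},\mathscr{E},n)$ and returns an integer $z$ with $|V-z/2^n|\le 2^{-n}$. 2. The value is not computable even under the promise that the MMG is determined with $V\in\{0,1\}$: there is no algorithm as in 1 whose correctness is required only for these MMGs, nor is there an algorithm that, for every such MMG, halts on input $(\mathscr{A},\mathscr{E})$ and returns $V$. -/

import Mathlib

/-! Matrix multiplication games (MMGs) and computability of their value. -/

namespace MMG

noncomputable section

/-- The entrywise `1`-norm of a real matrix. -/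
def oneNorm {m n : ℕ} (B : Matrix (Fin m) (Fin n) ℝ) : ℝ :=
  ∑ i, ∑ j, |B i j|

section Game

variable {M N : ℕ} (𝒜 : Set (Matrix (Fin M) (Fin N) ℝ)) (ℰ : Set (Matrix (Fin N) (Fin M) ℝ))

/-- A finite history `A₁E₁⋯AₖEₖ`, i.e. a word of `(𝒜·ℰ)*`. -/
abbrev History : Type := List (𝒜 × ℰ)

/-- A strategy of Adam maps every finite history to his next matrix. -/
abbrev AdamStrategy : Type := History 𝒜 ℰ → 𝒜

/-- A strategy of Eve maps every finite history, followed by Adam's next matrix, to her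
next matrix. -/
abbrev EveStrategy : Type := History 𝒜 ℰ → 𝒜 → ℰ

variable {𝒜 ℰ}

/-- The turn played by the two strategies after the history `h`. -/
def turn (σ : AdamStrategy 𝒜 ℰ) (τ : EveStrategy 𝒜 ℰ) (h : History 𝒜 ℰ) : 𝒜 × ℰ :=
  (σ h, τ h (σ h))

/-- The history after `k` turns when Adam follows `σ` and Eve follows `τ`. -/
def history (σ : AdamStrategy 𝒜 ℰ) (τ : EveStrategy 𝒜 ℰ) : ℕ → History 𝒜 ℰ
  | 0 => []
  | k + 1 => history σ τ k ++ [turn σ τ (history σ τ k)]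

/-- The unique play compatible with `σ` and `τ` (the turns are numbered from `0`). -/
def play (σ : AdamStrategy 𝒜 ℰ) (τ : EveStrategy 𝒜 ℰ) (k : ℕ) : 𝒜 × ℰ :=
  turn σ τ (history σ τ k)

/-- The product, from left to right, of the `A·E` of the first `k` turns of a play. -/
def partialProduct (π : ℕ → 𝒜 × ℰ) : ℕ → Matrix (Fin M) (Fin M) ℝ
  | 0 => 1
  | k + 1 => partialProduct π k * ((π k).1.1 * (π k).2.1)

/-- The payoff of a play: the growth rate of the norm of the product. For bounded `𝒜` and `ℰ`
(in particular for finite sets) the sequence is bounded, so that this is a genuine limsup. -/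
def payoff (π : ℕ → 𝒜 × ℰ) : ℝ :=
  Filter.limsup (fun k : ℕ => oneNorm (partialProduct π k) ^ (1 / (k : ℝ))) Filter.atTop

variable (𝒜 ℰ)

/-- The game is determined with value `V`: Adam has a strategy that guarantees a payoff `≤ V`
and Eve has a strategy that guarantees a payoff `≥ V`. -/
def HasValue (V : ℝ) : Prop :=
  (∃ σ₀ : AdamStrategy 𝒜 ℰ, ∀ τ : EveStrategy 𝒜 ℰ, payoff (play σ₀ τ) ≤ V) ∧
  (∃ τ₀ : EveStrategy 𝒜 ℰ, ∀ σ : AdamStrategy 𝒜 ℰ, V ≤ payoff (play σ τ₀))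

end Game

/-- An MMG given by explicit finite lists of integer matrices. -/
structure IntMMG where
  M : ℕ
  N : ℕ
  M_pos : 0 < M
  N_pos : 0 < N
  adam : List (Matrix (Fin M) (Fin N) ℤ)
  eve : List (Matrix (Fin N) (Fin M) ℤ)

/-- The set of the matrices of a list, with entries regarded as real numbers. -/
def realSet {m n : ℕ} (L : List (Matrix (Fin m) (Fin n) ℤ)) : Set (Matrix (Fin m) (Fin n) ℝ) :=
  {B | ∃ C ∈ L, B = C.map (fun z : ℤ => (z : ℝ))}

/-- The integer MMG is determined with value `V`. -/
def IntMMG.HasValue (G : IntMMG) (V : ℝ) : Prop :=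
  MMG.HasValue (realSet G.adam) (realSet G.eve) V

/-- The integer MMG is determined. -/
def IntMMG.Determined (G : IntMMG) : Prop :=
  ∃ V : ℝ, G.HasValue V

/-- A matrix written down as the list of its rows. -/
def matrixCode {m n : ℕ} (B : Matrix (Fin m) (Fin n) ℤ) : List (List ℤ) :=
  List.ofFn fun i => List.ofFn fun j => B i j

/-- The inputs of algorithms on MMGs: the two dimensions, Adam's matrices, Eve's matrices. -/
abbrev Code : Type := (ℕ × ℕ) × List (List (List ℤ)) × List (List (List ℤ))

/-- The description of an integer MMG that is handed to an algorithm. -/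
def IntMMG.code (G : IntMMG) : Code :=
  ((G.M, G.N), G.adam.map matrixCode, G.eve.map matrixCode)

/-- The value is computable (as a real number, from the matrices) on the class `S` of determined
games: some algorithm, given the matrices of a game in `S` and a precision `n`, halts and returns
the numerator of a dyadic rational `z / 2 ^ n` at distance at most `2 ^ (-n)` from the value.
Nothing is required of the algorithm outside `S`. -/
def ValueComputableOn (S : Set IntMMG) : Prop :=
  ∃ f : Code × ℕ →. ℤ, Partrec f ∧
    ∀ G ∈ S, ∀ V : ℝ, G.HasValue V →
      ∀ n : ℕ, ∃ z ∈ f (G.code, n), |V - (z : ℝ) / 2 ^ n| ≤ 1 / 2 ^ n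

/-- The value is exactly computable on the class `S` of determined games with integer values:
some algorithm, given the matrices of a game in `S`, halts and returns the value. -/
def ValueExactlyComputableOn (S : Set IntMMG) : Prop :=
  ∃ f : Code →. ℤ, Partrec f ∧
    ∀ G ∈ S, ∀ V : ℝ, G.HasValue V → ∃ z ∈ f G.code, (z : ℝ) = V

end

end MMG

/-! Eve plays no role: her only matrix is the identity, while Adam has the identity and a list `L`
of square integer matrices. If some product over `L` is zero, Adam plays it and the value is `0`.
Otherwise every partial product is a nonzero integer matrix, hence of norm at least `1`, and Adam
attains `1` by always playing the identity. So the value decides whether `L` is mortal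
(`soloGame_hasValue_zero`, `soloGame_hasValue_one`).

Mortality encodes halting. A configuration of a Turing machine becomes an integer vector, with half
tapes read as numbers in a fixed base. Pushing a symbol is affine; popping needs a division, so the
quotient is guessed in a register and a linear equation checks the guess. Linear updates guarded by
linear equations turn into matrices acting on the products of two coordinates, together with an
accumulator that adds up the squares of the guards (`squareVec_vecMul`). A rank one matrix tests
that the accumulator and the state coordinate vanish and then restarts the run; a zero product
exists exactly when some run is accepted (`exists_prod_eq_zero_iff`).

Only the rank one matrix depends on the input, so the reduction is computable (`exists_reduction`),
and an approximation of the value that separates `0` from `1` would solve the halting problem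
(`false_of_separates`). -/

namespace MMG

open Filter Topology

/-! ### The entrywise norm. -/

section OneNorm

variable {m n p : ℕ}

lemma oneNorm_nonneg (B : Matrix (Fin m) (Fin n) ℝ) : 0 ≤ oneNorm B :=
  Finset.sum_nonneg fun _ _ => Finset.sum_nonneg fun _ _ => abs_nonneg _

lemma oneNorm_zero : oneNorm (0 : Matrix (Fin m) (Fin n) ℝ) = 0 := by simp [oneNorm]

lemma oneNorm_one : oneNorm (1 : Matrix (Fin n) (Fin n) ℝ) = n := by
  simp [oneNorm, Matrix.one_apply, apply_ite abs]

lemma abs_le_oneNorm (B : Matrix (Fin m) (Fin n) ℝ) (i : Fin m) (j : Fin n) :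
    |B i j| ≤ oneNorm B :=
  (Finset.single_le_sum (f := fun j => |B i j|) (fun _ _ => abs_nonneg _)
      (Finset.mem_univ j)).trans
    (Finset.single_le_sum (f := fun i => ∑ j, |B i j|)
      (fun _ _ => Finset.sum_nonneg fun _ _ => abs_nonneg _) (Finset.mem_univ i))

lemma oneNorm_mul_le (A : Matrix (Fin m) (Fin n) ℝ) (B : Matrix (Fin n) (Fin p) ℝ) :
    oneNorm (A * B) ≤ oneNorm A * oneNorm B := by
  have hrow (k : Fin n) : ∑ j, |B k j| ≤ oneNorm B :=
    Finset.single_le_sum (f := fun k => ∑ j, |B k j|)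
      (fun _ _ => Finset.sum_nonneg fun _ _ => abs_nonneg _) (Finset.mem_univ k)
  calc oneNorm (A * B) ≤ ∑ i, ∑ j, ∑ k, |A i k| * |B k j| := by
        refine Finset.sum_le_sum fun i _ => Finset.sum_le_sum fun j _ => ?_
        rw [Matrix.mul_apply]
        exact (Finset.abs_sum_le_sum_abs _ _).trans_eq (by simp [abs_mul])
    _ = ∑ i, ∑ k, |A i k| * ∑ j, |B k j| := by
        refine Finset.sum_congr rfl fun i _ => ?_
        rw [Finset.sum_comm]
        simp [Finset.mul_sum]
    _ ≤ ∑ i, ∑ k, |A i k| * oneNorm B :=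
        Finset.sum_le_sum fun i _ => Finset.sum_le_sum fun k _ =>
          mul_le_mul_of_nonneg_left (hrow k) (abs_nonneg _)
    _ = oneNorm A * oneNorm B := by simp [oneNorm, Finset.sum_mul]

lemma one_le_oneNorm_map {B : Matrix (Fin m) (Fin n) ℤ} (hB : B ≠ 0) :
    1 ≤ oneNorm (B.map (fun z : ℤ => (z : ℝ))) := by
  obtain ⟨i, j, hij⟩ : ∃ i j, B i j ≠ 0 := by
    by_contra! h
    exact hB (Matrix.ext h)
  refine le_trans ?_ (abs_le_oneNorm _ i j)
  simp only [Matrix.map_apply, ← Int.cast_abs]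
  exact_mod_cast Int.one_le_abs hij

end OneNorm

/-! ### Growth rates of plays. -/

section Payoff

variable {M N : ℕ} {𝒜 : Set (Matrix (Fin M) (Fin N) ℝ)} {ℰ : Set (Matrix (Fin N) (Fin M) ℝ)}

/-- A real `limsup` can be bounded below by its terms only if the sequence is bounded above;
submultiplicativity of the norm gives this bound. -/
lemma isBoundedUnder_growth (h𝒜 : 𝒜.Finite) (hℰ : ℰ.Finite) (π : ℕ → 𝒜 × ℰ) :
    IsBoundedUnder (· ≤ ·) atTop
      fun k : ℕ => oneNorm (partialProduct π k) ^ (1 / (k : ℝ)) := by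
  obtain ⟨a, ha⟩ := (h𝒜.image oneNorm).bddAbove
  obtain ⟨e, he⟩ := (hℰ.image oneNorm).bddAbove
  set C : ℝ := max a 0 * max e 0 + 1 with hC
  have hC1 : 1 ≤ C := by
    have : 0 ≤ max a 0 * max e 0 := mul_nonneg (le_max_right _ _) (le_max_right _ _)
    linarith
  have hstep (k : ℕ) : oneNorm ((π k).1.1 * (π k).2.1) ≤ C := by
    have h1 : oneNorm (π k).1.1 ≤ max a 0 :=
      (ha ⟨_, (π k).1.2, rfl⟩).trans (le_max_left _ _)
    have h2 : oneNorm (π k).2.1 ≤ max e 0 :=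
      (he ⟨_, (π k).2.2, rfl⟩).trans (le_max_left _ _)
    have := mul_le_mul h1 h2 (oneNorm_nonneg _) (le_max_right _ _)
    linarith [oneNorm_mul_le (π k).1.1 (π k).2.1]
  have hprod (k : ℕ) : oneNorm (partialProduct π k) ≤ M * C ^ k := by
    induction k with
    | zero => simp [partialProduct, oneNorm_one]
    | succ k ih =>
      calc oneNorm (partialProduct π (k + 1))
          ≤ oneNorm (partialProduct π k) * oneNorm ((π k).1.1 * (π k).2.1) := oneNorm_mul_le _ _
        _ ≤ (M * C ^ k) * C := mul_le_mul ih (hstep k) (oneNorm_nonneg _) (by positivity)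
        _ = M * C ^ (k + 1) := by ring
  -- The factor `M`, the norm of the identity, is absorbed by `M ≤ (M + 1) ^ k` for `k ≥ 1`.
  refine ⟨(M + 1) * C, eventually_map.2 ?_⟩
  filter_upwards [eventually_ge_atTop 1] with k hk
  have hk0 : (k : ℝ) ≠ 0 := by positivity
  have hle : oneNorm (partialProduct π k) ≤ ((M + 1) * C) ^ k := by
    refine (hprod k).trans ?_
    rw [mul_pow]
    refine mul_le_mul_of_nonneg_right ?_ (by positivity)
    exact (le_add_of_nonneg_right zero_le_one).trans
      (le_self_pow₀ (by linarith [Nat.cast_nonneg (α := ℝ) M]) (by omega))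
  calc oneNorm (partialProduct π k) ^ (1 / (k : ℝ))
      ≤ (((M + 1) * C) ^ k) ^ (1 / (k : ℝ)) :=
        Real.rpow_le_rpow (oneNorm_nonneg _) hle (by positivity)
    _ = (M + 1) * C := by
        rw [one_div, Real.pow_rpow_inv_natCast (by positivity) (by omega)]

lemma le_payoff (h𝒜 : 𝒜.Finite) (hℰ : ℰ.Finite) (π : ℕ → 𝒜 × ℰ) {V : ℝ}
    (h : ∀ k : ℕ, V ≤ oneNorm (partialProduct π k) ^ (1 / (k : ℝ))) : V ≤ payoff π :=
  le_limsup_of_frequently_le (Frequently.of_forall h) (isBoundedUnder_growth h𝒜 hℰ π)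

lemma payoff_eq_zero (π : ℕ → 𝒜 × ℰ) {n : ℕ} (h : partialProduct π n = 0) : payoff π = 0 := by
  have hz (k : ℕ) (hk : n ≤ k) : partialProduct π k = 0 := by
    induction k, hk using Nat.le_induction with
    | base => exact h
    | succ k _ ih => rw [partialProduct, ih, Matrix.zero_mul]
  have : (fun k : ℕ => oneNorm (partialProduct π k) ^ (1 / (k : ℝ))) =ᶠ[atTop] fun _ => 0 := by
    -- The index `0` is excluded because its exponent `1 / 0` is `0`, and `0 ^ 0 = 1`.
    filter_upwards [eventually_ge_atTop n, eventually_ge_atTop 1] with k hk hk1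
    rw [hz k hk, oneNorm_zero, Real.zero_rpow]
    positivity
  rw [payoff, limsup_congr this, limsup_const]

lemma payoff_eq_one (hM : 0 < M) (π : ℕ → 𝒜 × ℰ) (h : ∀ k, partialProduct π k = 1) :
    payoff π = 1 := by
  refine Tendsto.limsup_eq ?_
  simp only [h, oneNorm_one]
  have hM' : (M : ℝ) ≠ 0 := by positivity
  have := (Real.continuous_const_rpow hM').continuousAt.tendsto.comp
    (tendsto_one_div_atTop_nhds_zero_nat (𝕜 := ℝ))
  simpa [Function.comp_def] using this

lemma length_history (σ : AdamStrategy 𝒜 ℰ) (τ : EveStrategy 𝒜 ℰ) (k : ℕ) :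
    (history σ τ k).length = k := by
  induction k with
  | zero => rfl
  | succ k ih => simp [history, ih]

end Payoff

/-! ### Matrix mortality as a one-player game. -/

section Mortality

variable {d : ℕ}

/-- The game in which Adam plays the identity or a matrix of `L` and Eve can only pass. -/
def soloGame (hd : 0 < d) (L : List (Matrix (Fin d) (Fin d) ℤ)) : IntMMG :=
  ⟨d, d, hd, hd, 1 :: L, [1]⟩

lemma realSet_finite {m n : ℕ} (L : List (Matrix (Fin m) (Fin n) ℤ)) : (realSet L).Finite := by
  refine ((L.finite_toSet).image fun C => C.map (fun z : ℤ => (z : ℝ))).subset ?_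
  rintro B ⟨C, hC, rfl⟩
  exact ⟨C, hC, rfl⟩

lemma map_one_cast : (1 : Matrix (Fin d) (Fin d) ℤ).map (fun z : ℤ => (z : ℝ)) = 1 := by
  simp [Matrix.map_one]

lemma map_mul_cast (A B : Matrix (Fin d) (Fin d) ℤ) :
    (A * B).map (fun z : ℤ => (z : ℝ)) =
      A.map (fun z : ℤ => (z : ℝ)) * B.map (fun z : ℤ => (z : ℝ)) :=
  Matrix.map_mul (f := Int.castRingHom ℝ)

lemma coe_realSet_one (E : realSet [(1 : Matrix (Fin d) (Fin d) ℤ)]) :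
    (E : Matrix (Fin d) (Fin d) ℝ) = 1 := by
  obtain ⟨C, hC, h⟩ := E.2
  rw [List.mem_singleton.1 hC] at h
  rw [h, map_one_cast]

lemma partialProduct_succ_of_one {𝒜 : Set (Matrix (Fin d) (Fin d) ℝ)}
    (π : ℕ → 𝒜 × realSet [(1 : Matrix (Fin d) (Fin d) ℤ)]) (k : ℕ) :
    partialProduct π (k + 1) = partialProduct π k * (π k).1.1 := by
  rw [partialProduct, coe_realSet_one, mul_one]

/-- Identity moves leave the product unchanged, so they can be dropped from the word. -/
lemma exists_partialProduct_eq_prod {L : List (Matrix (Fin d) (Fin d) ℤ)}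
    (π : ℕ → realSet (1 :: L) × realSet [(1 : Matrix (Fin d) (Fin d) ℤ)]) (k : ℕ) :
    ∃ l : List (Matrix (Fin d) (Fin d) ℤ), (∀ A ∈ l, A ∈ L) ∧
      partialProduct π k = l.prod.map (fun z : ℤ => (z : ℝ)) := by
  induction k with
  | zero => exact ⟨[], by simp, by simp [partialProduct]⟩
  | succ k ih =>
    obtain ⟨l, hl, h⟩ := ih
    obtain ⟨C, hC, hA⟩ := (π k).1.2
    rw [partialProduct_succ_of_one, h, hA, ← map_mul_cast]
    rcases List.mem_cons.1 hC with rfl | hC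
    · exact ⟨l, hl, by rw [mul_one]⟩
    · refine ⟨l ++ [C], fun A hA => ?_, by simp⟩
      rcases List.mem_append.1 hA with hA | hA
      · exact hl A hA
      · rwa [List.mem_singleton.1 hA]

/-- Adam spells out the word `l`, after which the product stays zero; Eve's guarantee is the
nonnegativity of norms. -/
theorem soloGame_hasValue_zero (hd : 0 < d) (L l : List (Matrix (Fin d) (Fin d) ℤ))
    (hl : ∀ A ∈ l, A ∈ L) (h0 : l.prod = 0) : (soloGame hd L).HasValue 0 := by
  change MMG.HasValue (realSet (1 :: L)) (realSet [(1 : Matrix (Fin d) (Fin d) ℤ)]) 0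
  have hone : (1 : Matrix (Fin d) (Fin d) ℤ).map (fun z : ℤ => (z : ℝ)) ∈ realSet [1] :=
    ⟨1, by simp, rfl⟩
  have hmem (k : ℕ) : l.getD k 1 ∈ 1 :: L := by
    rw [List.getD_eq_getElem?_getD]
    rcases lt_or_ge k l.length with hk | hk
    · simp [List.getElem?_eq_getElem hk, hl _ (List.getElem_mem hk)]
    · simp [List.getElem?_eq_none hk]
  let σ : AdamStrategy (realSet (1 :: L)) (realSet [(1 : Matrix (Fin d) (Fin d) ℤ)]) :=
    -- The length of the history is the position in the word; the default `1` is played once the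
    -- word is exhausted.
    fun h => ⟨(l.getD h.length 1).map (fun z : ℤ => (z : ℝ)), _, hmem _, rfl⟩
  refine ⟨⟨σ, fun τ => (payoff_eq_zero (n := l.length) _ ?_).le⟩, fun _ _ => ⟨_, hone⟩,
    fun σ => le_payoff (realSet_finite _) (realSet_finite _) _
      fun k => Real.rpow_nonneg (oneNorm_nonneg _) _⟩
  have key (k : ℕ) (hk : k ≤ l.length) :
      partialProduct (play σ τ) k = (l.take k).prod.map (fun z : ℤ => (z : ℝ)) := by
    induction k with
    | zero => simp [partialProduct]
    | succ k ih =>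
      have hk' : k < l.length := hk
      have hA : (play σ τ k).1.1 = l[k].map (fun z : ℤ => (z : ℝ)) := by
        simp only [play, turn, σ]
        rw [length_history, List.getD_eq_getElem _ _ hk']
      rw [partialProduct_succ_of_one, ih hk'.le, hA, ← map_mul_cast, List.prod_take_succ _ _ hk']
  rw [key _ le_rfl, List.take_length, h0]
  exact Matrix.map_zero _ Int.cast_zero

/-- Adam's guarantee comes from playing only the identity, Eve's from the fact that a nonzero
integer matrix has norm at least `1`. -/
theorem soloGame_hasValue_one (hd : 0 < d) (L : List (Matrix (Fin d) (Fin d) ℤ))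
    (hL : ∀ l : List (Matrix (Fin d) (Fin d) ℤ), (∀ A ∈ l, A ∈ L) → l.prod ≠ 0) :
    (soloGame hd L).HasValue 1 := by
  change MMG.HasValue (realSet (1 :: L)) (realSet [(1 : Matrix (Fin d) (Fin d) ℤ)]) 1
  have hone (l : List (Matrix (Fin d) (Fin d) ℤ)) :
      (1 : Matrix (Fin d) (Fin d) ℤ).map (fun z : ℤ => (z : ℝ)) ∈ realSet (1 :: l) :=
    ⟨1, by simp, rfl⟩
  refine ⟨⟨fun _ => ⟨_, hone L⟩, fun τ => (payoff_eq_one hd _ fun k => ?_).le⟩,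
    fun _ _ => ⟨_, hone []⟩, fun σ => le_payoff (realSet_finite _) (realSet_finite _) _
      fun k => ?_⟩
  · induction k with
    | zero => rfl
    | succ k ih =>
      rw [partialProduct_succ_of_one, ih, one_mul]
      exact map_one_cast
  · obtain ⟨l, hl, h⟩ := exists_partialProduct_eq_prod (L := L) (play σ fun _ _ => ⟨_, hone []⟩) k
    refine Real.one_le_rpow ?_ (by positivity)
    rw [h]
    exact one_le_oneNorm_map (hL l hl)

end Mortality

end MMG

namespace MMG

open Matrix

/-! ### From guarded linear updates to mortality. -/

section GuardedRules

variable {κ : Type*} [Fintype κ]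

/-- A linear update of an integer vector, guarded by the vanishing of finitely many linear forms. -/
structure Rule (κ : Type*) where
  /-- The matrix by which the vector is multiplied. -/
  update : Matrix κ κ ℤ
  /-- The linear forms that have to vanish. -/
  guards : List (κ → ℤ)

/-- A sequence of rules leads from `x` to a vector with vanishing coordinate `s`, and all the guards
on the way vanish. -/
def Accepts (s : κ) : (κ → ℤ) → List (Rule κ) → Prop
  | x, [] => x s = 0
  | x, r :: rs => (∀ g ∈ r.guards, g ⬝ᵥ x = 0) ∧ Accepts s (r.update *ᵥ x) rs

/-- The sum of the squares of the guards. -/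
def Rule.penalty (r : Rule κ) (x : κ → ℤ) : ℤ :=
  (r.guards.map fun g => (g ⬝ᵥ x) ^ 2).sum

/-- The linear map that updates the products of two coordinates of a vector and adds the penalty of
the rule to an accumulator. It acts on row vectors. -/
def Rule.matrix (r : Rule κ) : Matrix (κ × κ ⊕ Unit) (κ × κ ⊕ Unit) ℤ :=
  fromBlocks (of fun p q => r.update q.1 p.1 * r.update q.2 p.2)
    (of fun p _ => (r.guards.map fun g => g p.1 * g p.2).sum) 0 1

/-- The products of two coordinates of `x`, and the accumulator `e`. -/
def squareVec (x : κ → ℤ) (e : ℤ) : κ × κ ⊕ Unit → ℤ :=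
  Sum.elim (fun p => x p.1 * x p.2) fun _ => e

lemma sum_dotProduct_sq (gs : List (κ → ℤ)) (x : κ → ℤ) :
    (gs.map fun g => (g ⬝ᵥ x) ^ 2).sum =
      ∑ p : κ × κ, x p.1 * x p.2 * (gs.map fun g => g p.1 * g p.2).sum := by
  induction gs with
  | nil => simp
  | cons g gs ih =>
    simp only [List.map_cons, List.sum_cons, ih, mul_add, Finset.sum_add_distrib]
    congr 1
    rw [sq, dotProduct, Finset.sum_mul_sum, Fintype.sum_prod_type]
    exact Finset.sum_congr rfl fun i _ => Finset.sum_congr rfl fun j _ => by ring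

/-- Both the products of the updated coordinates and the penalty are quadratic forms in `x`, hence
linear in the products of coordinates. Using row vectors makes the order of the factors agree with
the order of the rules. -/
lemma squareVec_vecMul (r : Rule κ) (x : κ → ℤ) (e : ℤ) :
    squareVec x e ᵥ* r.matrix = squareVec (r.update *ᵥ x) (e + r.penalty x) := by
  rw [Rule.matrix, squareVec, vecMul_fromBlocks]
  funext i
  rcases i with ⟨i, j⟩ | i
  · simp only [squareVec, Sum.elim_inl, vecMul_zero, add_zero,
      Function.comp_def, Sum.elim_inr]
    simp only [vecMul, mulVec, dotProduct, of_apply, Fintype.sum_prod_type, Finset.sum_mul_sum]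
    exact Finset.sum_congr rfl fun k _ => Finset.sum_congr rfl fun l _ => by ring
  · simp only [squareVec, Sum.elim_inr, Pi.add_apply, Function.comp_def, Sum.elim_inl,
      vecMul_one, Rule.penalty, sum_dotProduct_sq]
    rw [add_comm]
    rfl

lemma Rule.penalty_nonneg (r : Rule κ) (x : κ → ℤ) : 0 ≤ r.penalty x :=
  List.sum_nonneg (by simp only [List.mem_map]; rintro _ ⟨g, -, rfl⟩; positivity)

lemma Rule.penalty_eq_zero_iff (r : Rule κ) (x : κ → ℤ) :
    r.penalty x = 0 ↔ ∀ g ∈ r.guards, g ⬝ᵥ x = 0 := by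
  unfold Rule.penalty
  induction r.guards with
  | nil => simp
  | cons g gs ih =>
    have h : 0 ≤ (gs.map fun g => (g ⬝ᵥ x) ^ 2).sum :=
      List.sum_nonneg (by simp only [List.mem_map]; rintro _ ⟨g, -, rfl⟩; positivity)
    rw [List.map_cons, List.sum_cons, add_eq_zero_iff_of_nonneg (sq_nonneg _) h, ih]
    simp

variable [DecidableEq κ]

/-- The linear form that adds the square of the coordinate `s` and the accumulator. -/
def finalForm (s : κ) : κ × κ ⊕ Unit → ℤ :=
  Sum.elim (fun p => if p = (s, s) then 1 else 0) fun _ => 1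

lemma squareVec_dotProduct_finalForm (s : κ) (x : κ → ℤ) (e : ℤ) :
    squareVec x e ⬝ᵥ finalForm s = e + x s ^ 2 := by
  simp [squareVec, finalForm, dotProduct, sq, add_comm]

/-- The final number is a sum of squares added to `e ≥ 0`. Nothing can cancel, so it vanishes only
if `e`, every guard on the way and the last coordinate `s` do. -/
lemma prod_dotProduct_finalForm_eq_zero_iff (s : κ) (rs : List (Rule κ)) (x : κ → ℤ) {e : ℤ}
    (he : 0 ≤ e) :
    (squareVec x e ᵥ* (rs.map Rule.matrix).prod) ⬝ᵥ finalForm s = 0 ↔ e = 0 ∧ Accepts s x rs := by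
  induction rs generalizing x e with
  | nil =>
    simp [squareVec_dotProduct_finalForm, add_eq_zero_iff_of_nonneg he (sq_nonneg _), Accepts]
  | cons r rs ih =>
    rw [List.map_cons, List.prod_cons, ← vecMul_vecMul, squareVec_vecMul,
      ih _ (add_nonneg he (r.penalty_nonneg x)),
      add_eq_zero_iff_of_nonneg he (r.penalty_nonneg x), r.penalty_eq_zero_iff, and_assoc]
    rfl

/-- The preserved coordinate `o` certifies that the vector of a run never becomes zero. -/
lemma squareVec_vecMul_prod_one {o : κ} {R : List (Rule κ)}
    (hR : ∀ r ∈ R, ∀ x, (r.update *ᵥ x) o = x o) (rs : List (Rule κ)) (hrs : ∀ r ∈ rs, r ∈ R)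
    (x : κ → ℤ) (e : ℤ) :
    (squareVec x e ᵥ* (rs.map Rule.matrix).prod) (Sum.inl (o, o)) = x o * x o := by
  induction rs generalizing x e with
  | nil => simp [squareVec]
  | cons r rs ih =>
    rw [List.map_cons, List.prod_cons, ← vecMul_vecMul, squareVec_vecMul,
      ih (fun r hr => hrs r (List.mem_cons_of_mem _ hr)), hR r (hrs r List.mem_cons_self)]

/-- The rank one matrix that checks acceptance and starts again from `x`. -/
def restart (s : κ) (x : κ → ℤ) : Matrix (κ × κ ⊕ Unit) (κ × κ ⊕ Unit) ℤ :=
  vecMulVec (finalForm s) (squareVec x 0)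

theorem exists_prod_eq_zero_iff {o s : κ} {R : List (Rule κ)}
    (hR : ∀ r ∈ R, ∀ x, (r.update *ᵥ x) o = x o) {x : κ → ℤ} (hx : x o = 1) :
    (∃ l : List (Matrix (κ × κ ⊕ Unit) (κ × κ ⊕ Unit) ℤ),
      (∀ A ∈ l, A ∈ restart s x :: R.map Rule.matrix) ∧ l.prod = 0) ↔
    ∃ rs : List (Rule κ), (∀ r ∈ rs, r ∈ R) ∧ Accepts s x rs := by
  constructor
  · rintro ⟨l, hl, h0⟩
    by_contra! hacc
    -- Applied to the initial row vector, every word yields a nonzero multiple of a run without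
    -- restarts: a restart discards the current run and multiplies by its final number, which is
    -- nonzero as no run is accepted.
    have key : ∃ c : ℤ, c ≠ 0 ∧ ∃ rs : List (Rule κ), (∀ r ∈ rs, r ∈ R) ∧
        squareVec x 0 ᵥ* l.prod = c • (squareVec x 0 ᵥ* (rs.map Rule.matrix).prod) := by
      clear h0
      induction l using List.reverseRecOn with
      | nil => exact ⟨1, one_ne_zero, [], by simp, by simp⟩
      | append_singleton l A ih =>
        obtain ⟨c, hc, rs, hrs, h⟩ := ih fun A hA => hl A (List.mem_append_left _ hA)
        rw [List.prod_append, List.prod_singleton, ← vecMul_vecMul, h, smul_vecMul]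
        rcases List.mem_cons.1 (hl A (by simp)) with rfl | hA
        · refine ⟨c * ((squareVec x 0 ᵥ* (rs.map Rule.matrix).prod) ⬝ᵥ finalForm s),
            mul_ne_zero hc fun h => hacc rs hrs
              ((prod_dotProduct_finalForm_eq_zero_iff s rs x le_rfl).1 h).2, [], by simp, ?_⟩
          rw [restart, vecMul_vecMulVec, mul_smul]
          simp
        · obtain ⟨r, hr, rfl⟩ := List.mem_map.1 hA
          refine ⟨c, hc, rs ++ [r], fun r' hr' => ?_, by simp [vecMul_vecMul]⟩
          rcases List.mem_append.1 hr' with h' | h'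
          · exact hrs r' h'
          · rwa [List.mem_singleton.1 h']
    obtain ⟨c, hc, rs, hrs, h⟩ := key
    rw [h0, vecMul_zero] at h
    have := congrFun h (Sum.inl (o, o))
    rw [Pi.smul_apply, squareVec_vecMul_prod_one hR rs hrs, hx] at this
    simp [hc.symm] at this
  · rintro ⟨rs, hrs, hacc⟩
    have h := (prod_dotProduct_finalForm_eq_zero_iff s rs x le_rfl).2 ⟨rfl, hacc⟩
    -- Between two copies of the rank one matrix, the product collapses to a multiple of that matrix
    -- by the final number of the run, which is zero.
    refine ⟨restart s x :: (rs.map Rule.matrix ++ [restart s x]), fun A hA => ?_, ?_⟩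
    · simp only [List.mem_cons, List.mem_append, List.mem_map, List.not_mem_nil, or_false] at hA ⊢
      rcases hA with hA | ⟨r, hr, rfl⟩ | hA
      · exact Or.inl hA
      · exact Or.inr ⟨r, hrs r hr, rfl⟩
      · exact Or.inl hA
    · rw [List.prod_cons, List.prod_append, List.prod_singleton, ← mul_assoc, restart,
        vecMulVec_mul, vecMulVec_mul_vecMulVec, h, zero_smul, vecMulVec_zero]

end GuardedRules

end MMG

namespace MMG

open Matrix Turing StateTransition

/-! ### Turing machines as guarded linear updates. -/

section Turing

variable {Γ Λ : Type*} [Inhabited Γ]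

/-- The number whose base `b` digits are the symbols of a half tape. -/
def tapeNum (b : ℕ) (num : Γ → ℕ) (h0 : num default = 0) (l : ListBlank Γ) : ℕ :=
  l.liftOn (fun l => l.foldr (fun a n => num a + b * n) 0) (by
    -- Trailing blanks are leading zeros of the number, because the blank has digit `0`.
    rintro l _ ⟨n, rfl⟩
    have (n : ℕ) : (List.replicate n (default : Γ)).foldr (fun a n => num a + b * n) 0 = 0 := by
      induction n with
      | zero => rfl
      | succ n ih => simp [List.replicate_succ, ih, h0]
    rw [List.foldr_append, this])

lemma tapeNum_mk (b : ℕ) (num : Γ → ℕ) (h0 : num default = 0) (l : List Γ) :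
    tapeNum b num h0 (ListBlank.mk l) = l.foldr (fun a n => num a + b * n) 0 := rfl

lemma tapeNum_cons (b : ℕ) (num : Γ → ℕ) (h0 : num default = 0) (a : Γ) (l : ListBlank Γ) :
    tapeNum b num h0 (l.cons a) = num a + b * tapeNum b num h0 l :=
  l.induction_on fun l => by rw [ListBlank.cons_mk, tapeNum_mk, tapeNum_mk, List.foldr_cons]

lemma tapeNum_eq (b : ℕ) (num : Γ → ℕ) (h0 : num default = 0) (l : ListBlank Γ) :
    tapeNum b num h0 l = num l.head + b * tapeNum b num h0 l.tail := by
  rw [← tapeNum_cons, ListBlank.cons_head_tail]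

/-- A numbering of the symbols and of the relevant states of a Turing machine. -/
structure Numbering (Γ Λ : Type*) [Inhabited Γ] (S : Finset Λ) where
  /-- The base of the representation of half tapes. -/
  base : ℕ
  /-- The number of a symbol. -/
  sym : Γ → ℕ
  /-- The number of a state. -/
  state : Λ → ℕ
  sym_default : sym default = 0
  sym_lt : ∀ a, sym a < base
  sym_inj : Function.Injective sym
  state_pos : ∀ q, 0 < state q
  state_inj : Set.InjOn state S

lemma nonempty_numbering [Fintype Γ] (S : Finset Λ) : Nonempty (Numbering Γ Λ S) := by
  classical
  let e := Fintype.equivFin Γ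
  have : NeZero (Fintype.card Γ) := ⟨Fintype.card_ne_zero⟩
  -- The swap gives the blank the digit `0`. States are numbered from `1`, which keeps `0` free to
  -- mark halting; the value outside `S` is arbitrary.
  refine ⟨⟨Fintype.card Γ, fun a => (Equiv.swap (e default) 0 (e a)).val,
    fun q => if h : q ∈ S then (S.equivFin ⟨q, h⟩).val + 1 else 1, by simp, fun a => Fin.is_lt _,
    fun a a' h => ?_, fun q => ?_, fun q hq q' hq' h => ?_⟩⟩
  · exact e.injective ((Equiv.swap _ _).injective (Fin.ext h))
  · split <;> omega
  · rw [Finset.mem_coe] at hq hq'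
    simp only [dif_pos hq, dif_pos hq'] at h
    simpa using S.equivFin.injective (Fin.ext (Nat.succ_injective h))

variable {S : Finset Λ} (ν : Numbering Γ Λ S)

/-- The number of a half tape. -/
def Numbering.tape (l : ListBlank Γ) : ℕ := tapeNum ν.base ν.sym ν.sym_default l

/-- A configuration as an integer vector: the constant `1`, the state, the left half tape, the
symbol under the head, the right half tape, and a register for guesses. -/
def Numbering.vec (c : TM0.Cfg Γ Λ) (y : ℕ) : Fin 6 → ℤ :=
  ![1, ν.state c.q, ν.tape c.Tape.left, ν.sym c.Tape.head, ν.tape c.Tape.right, y]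

/-- The rule that increments the register for guesses. -/
def incrRule : Rule (Fin 6) where
  update := !![1, 0, 0, 0, 0, 0;
               0, 1, 0, 0, 0, 0;
               0, 0, 1, 0, 0, 0;
               0, 0, 0, 1, 0, 0;
               0, 0, 0, 0, 1, 0;
               1, 0, 0, 0, 0, 1]
  guards := []

lemma incrRule_update (c : TM0.Cfg Γ Λ) (y : ℕ) :
    incrRule.update *ᵥ ν.vec c y = ν.vec c (y + 1) := by
  funext i
  fin_cases i <;>
    simp [incrRule, Numbering.vec, mulVec, dotProduct, Fin.sum_univ_succ, add_comm]

variable {ν}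

lemma accepts_replicate_incrRule (c : TM0.Cfg Γ Λ) (y k : ℕ) (rs : List (Rule (Fin 6)))
    (h : Accepts 1 (ν.vec c (y + k)) rs) :
    Accepts 1 (ν.vec c y) (List.replicate k incrRule ++ rs) := by
  induction k generalizing y with
  | zero => exact h
  | succ k ih =>
    refine ⟨by simp [incrRule], ?_⟩
    rw [incrRule_update]
    exact ih _ (by rwa [add_assoc, add_comm 1])

/-- Uniqueness of the last digit and the quotient in base `ν.base`: the guard of a move admits only
the correct guess. -/
lemma Numbering.digit_unique {a : Γ} {l : ListBlank Γ} {y : ℕ}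
    (h : ν.sym a + ν.base * y = ν.tape l) : l.head = a ∧ ν.tape l.tail = y := by
  have hl : ν.tape l = ν.sym l.head + ν.base * ν.tape l.tail := tapeNum_eq _ _ _ _
  rw [hl] at h
  have hb : 0 < ν.base := (Nat.zero_le _).trans_lt (ν.sym_lt a)
  have hmod := congrArg (· % ν.base) h
  simp only [Nat.add_mul_mod_self_left, Nat.mod_eq_of_lt (ν.sym_lt _)] at hmod
  rw [hmod] at h
  exact ⟨(ν.sym_inj hmod).symm, (Nat.eq_of_mul_eq_mul_left hb (Nat.add_left_cancel h)).symm⟩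

variable [Inhabited Λ]

variable (ν) in
/-- The rule for a transition of the machine from the state `q` reading the symbol `a`. When the head
moves, `a'` is the new symbol under the head, and the rest of the half tape from which it comes has
to be guessed beforehand. -/
def Numbering.rule (M : TM0.Machine Γ Λ) (q : Λ) (a a' : Γ) : Rule (Fin 6) :=
  match M q a with
  -- The state coordinate becomes `0`, the number of no state, which is the acceptance condition.
  | none =>
    { update := !![1, 0, 0, 0, 0, 0;
                   0, 0, 0, 0, 0, 0;
                   0, 0, 1, 0, 0, 0;
                   0, 0, 0, 1, 0, 0;
                   0, 0, 0, 0, 1, 0;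
                   0, 0, 0, 0, 0, 1]
      guards := [![-ν.state q, 1, 0, 0, 0, 0], ![-ν.sym a, 0, 0, 1, 0, 0]] }
  | some (q', TM0.Stmt.write c) =>
    { update := !![1, 0, 0, 0, 0, 0;
                   ν.state q', 0, 0, 0, 0, 0;
                   0, 0, 1, 0, 0, 0;
                   ν.sym c, 0, 0, 0, 0, 0;
                   0, 0, 0, 0, 1, 0;
                   0, 0, 0, 0, 0, 0]
      guards := [![-ν.state q, 1, 0, 0, 0, 0], ![-ν.sym a, 0, 0, 1, 0, 0]] }
  -- The third guard says that the left half tape is `a'` followed by the guess. The guess becomes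
  -- the new left half tape, `a` is pushed on the right one, and the register is reset.
  | some (q', TM0.Stmt.move Dir.left) =>
    { update := !![1, 0, 0, 0, 0, 0;
                   ν.state q', 0, 0, 0, 0, 0;
                   0, 0, 0, 0, 0, 1;
                   ν.sym a', 0, 0, 0, 0, 0;
                   ν.sym a, 0, 0, 0, ν.base, 0;
                   0, 0, 0, 0, 0, 0]
      guards := [![-ν.state q, 1, 0, 0, 0, 0], ![-ν.sym a, 0, 0, 1, 0, 0],
        ![-ν.sym a', 0, 1, 0, 0, -ν.base]] }
  | some (q', TM0.Stmt.move Dir.right) =>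
    { update := !![1, 0, 0, 0, 0, 0;
                   ν.state q', 0, 0, 0, 0, 0;
                   ν.sym a, 0, ν.base, 0, 0, 0;
                   ν.sym a', 0, 0, 0, 0, 0;
                   0, 0, 0, 0, 0, 1;
                   0, 0, 0, 0, 0, 0]
      guards := [![-ν.state q, 1, 0, 0, 0, 0], ![-ν.sym a, 0, 0, 1, 0, 0],
        ![-ν.sym a', 0, 0, 0, 1, -ν.base]] }

lemma Numbering.rule_update_zero (ν : Numbering Γ Λ S) (M : TM0.Machine Γ Λ) (q : Λ)
    (a a' : Γ) (x : Fin 6 → ℤ) :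
    ((ν.rule M q a a').update *ᵥ x) 0 = x 0 := by
  unfold Numbering.rule
  split <;> simp [mulVec, dotProduct, Fin.sum_univ_succ]

lemma Numbering.eq_of_guards {M : TM0.Machine Γ Λ} {q : Λ} {a a' : Γ} {c : TM0.Cfg Γ Λ} {y : ℕ}
    (hq : q ∈ S) (hc : c.q ∈ S) (h : ∀ g ∈ (ν.rule M q a a').guards, g ⬝ᵥ ν.vec c y = 0) :
    q = c.q ∧ a = c.Tape.head := by
  have h1 : ![-(ν.state q : ℤ), 1, 0, 0, 0, 0] ⬝ᵥ ν.vec c y = 0 := by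
    refine h _ ?_
    unfold Numbering.rule
    split <;> simp
  have h2 : ![-(ν.sym a : ℤ), 0, 0, 1, 0, 0] ⬝ᵥ ν.vec c y = 0 := by
    refine h _ ?_
    unfold Numbering.rule
    split <;> simp
  simp only [Numbering.vec, dotProduct, Fin.sum_univ_succ] at h1 h2
  simp at h1 h2
  exact ⟨ν.state_inj hq hc (by omega), ν.sym_inj (by omega)⟩

lemma Numbering.rule_sound {M : TM0.Machine Γ Λ} {c c' : TM0.Cfg Γ Λ} {a' : Γ} {y : ℕ}
    (hstep : c' ∈ TM0.step M c)
    (h : ∀ g ∈ (ν.rule M c.q c.Tape.head a').guards, g ⬝ᵥ ν.vec c y = 0) :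
    (ν.rule M c.q c.Tape.head a').update *ᵥ ν.vec c y = ν.vec c' 0 := by
  obtain ⟨q, T⟩ := c
  obtain ⟨⟨q', s⟩, hM, rfl⟩ := Option.map_eq_some_iff.1 hstep
  obtain (_ | _) | b := s <;> simp only [Numbering.rule, hM] at h ⊢
  · have h3 := h ![-ν.sym a', 0, 1, 0, 0, -ν.base] (by simp)
    simp [Numbering.vec, dotProduct, Fin.sum_univ_succ] at h3
    have h4 := ν.digit_unique (a := a') (l := T.left) (y := y) (by zify; linarith)
    have h5 : ν.tape (T.right.cons T.head) = ν.sym T.head + ν.base * ν.tape T.right :=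
      tapeNum_cons _ _ _ _ _
    funext i
    fin_cases i <;>
      simp [Numbering.vec, mulVec, dotProduct, Fin.sum_univ_succ, Tape.move, h4, h5]
  · have h3 := h ![-ν.sym a', 0, 0, 0, 1, -ν.base] (by simp)
    simp [Numbering.vec, dotProduct, Fin.sum_univ_succ] at h3
    have h4 := ν.digit_unique (a := a') (l := T.right) (y := y) (by zify; linarith)
    have h5 : ν.tape (T.left.cons T.head) = ν.sym T.head + ν.base * ν.tape T.left :=
      tapeNum_cons _ _ _ _ _
    funext i
    fin_cases i <;>
      simp [Numbering.vec, mulVec, dotProduct, Fin.sum_univ_succ, Tape.move, h4, h5]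
  · funext i
    fin_cases i <;>
      simp [Numbering.vec, mulVec, dotProduct, Fin.sum_univ_succ, Tape.write]

lemma Numbering.exists_guess {M : TM0.Machine Γ Λ} (c : TM0.Cfg Γ Λ) :
    ∃ (a' : Γ) (y : ℕ), ∀ g ∈ (ν.rule M c.q c.Tape.head a').guards, g ⬝ᵥ ν.vec c y = 0 := by
  obtain ⟨q, T⟩ := c
  have hl (l : ListBlank Γ) : ν.tape l = ν.sym l.head + ν.base * ν.tape l.tail :=
    tapeNum_eq _ _ _ _
  unfold Numbering.rule
  dsimp only
  split
  · exact ⟨default, 0, by simp [Numbering.vec, dotProduct, Fin.sum_univ_succ]⟩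
  · exact ⟨default, 0, by simp [Numbering.vec, dotProduct, Fin.sum_univ_succ]⟩
  · refine ⟨T.left.head, ν.tape T.left.tail, ?_⟩
    simp [Numbering.vec, dotProduct, Fin.sum_univ_succ, hl T.left]
  · refine ⟨T.right.head, ν.tape T.right.tail, ?_⟩
    simp [Numbering.vec, dotProduct, Fin.sum_univ_succ, hl T.right]

lemma Numbering.rule_halt {M : TM0.Machine Γ Λ} {q : Λ} {a a' : Γ} (hM : M q a = none)
    (x : Fin 6 → ℤ) : ((ν.rule M q a a').update *ᵥ x) 1 = 0 := by
  simp [Numbering.rule, hM, mulVec, dotProduct, Fin.sum_univ_succ]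

variable (ν) in
/-- All the rules that simulate the machine on the states of `S`. -/
noncomputable def Numbering.rules [Fintype Γ] (M : TM0.Machine Γ Λ) : List (Rule (Fin 6)) :=
  incrRule :: (S ×ˢ (Finset.univ : Finset (Γ × Γ))).toList.map fun p => ν.rule M p.1 p.2.1 p.2.2

lemma Numbering.rules_update_zero [Fintype Γ] (M : TM0.Machine Γ Λ) :
    ∀ r ∈ ν.rules M, ∀ x, (r.update *ᵥ x) 0 = x 0 := by
  intro r hr x
  rcases List.mem_cons.1 hr with rfl | hr
  · simp [incrRule, mulVec, dotProduct, Fin.sum_univ_succ]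
  · obtain ⟨p, -, rfl⟩ := List.mem_map.1 hr
    exact ν.rule_update_zero M _ _ _ _

lemma TM0_step_eq_none {M : TM0.Machine Γ Λ} {c : TM0.Cfg Γ Λ} :
    TM0.step M c = none ↔ M c.q c.Tape.head = none := by
  obtain ⟨q, T⟩ := c
  exact Option.map_eq_none_iff

/-- Guards leave three possibilities for a rule: an increment of the register, the true next step of
the machine, or a halting rule on a halted configuration. Since states have positive numbers,
acceptance requires the last one. `TM0.Supports` keeps the run in `S`, where states are told apart
by their numbers. -/
lemma Numbering.dom_of_accepts [Fintype Γ] {M : TM0.Machine Γ Λ} (hS : TM0.Supports M (S : Set Λ))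
    (rs : List (Rule (Fin 6))) (hrs : ∀ r ∈ rs, r ∈ ν.rules M) {c : TM0.Cfg Γ Λ} (hc : c.q ∈ S)
    {y : ℕ} (h : Accepts 1 (ν.vec c y) rs) : (eval (TM0.step M) c).Dom := by
  induction rs generalizing c y with
  | nil =>
    have h0 : (ν.state c.q : ℤ) = 0 := h
    have := ν.state_pos c.q
    omega
  | cons r rs ih =>
    have hrs' : ∀ r ∈ rs, r ∈ ν.rules M := fun r hr => hrs r (List.mem_cons_of_mem _ hr)
    obtain ⟨hg, hacc⟩ := h
    rcases List.mem_cons.1 (hrs r List.mem_cons_self) with rfl | hr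
    · rw [incrRule_update] at hacc
      exact ih hrs' hc hacc
    · obtain ⟨⟨q, a, a'⟩, hp, rfl⟩ := List.mem_map.1 hr
      have hq : q ∈ S := by simpa using hp
      obtain ⟨rfl, rfl⟩ := Numbering.eq_of_guards hq hc hg
      rcases hstep : TM0.step M c with _ | c'
      · exact Part.dom_iff_mem.2 ⟨c, mem_eval.2 ⟨Relation.ReflTransGen.refl, hstep⟩⟩
      · rw [Numbering.rule_sound hstep hg] at hacc
        rw [reaches_eval (Relation.ReflTransGen.single hstep)]
        exact ih hrs' (TM0.step_supports M hS hstep hc) hacc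

lemma Numbering.exists_accepts_of_dom [Fintype Γ] {M : TM0.Machine Γ Λ}
    (hS : TM0.Supports M (S : Set Λ)) {c : TM0.Cfg Γ Λ} (hc : c.q ∈ S)
    (h : (eval (TM0.step M) c).Dom) :
    ∃ rs : List (Rule (Fin 6)), (∀ r ∈ rs, r ∈ ν.rules M) ∧ Accepts 1 (ν.vec c 0) rs := by
  obtain ⟨c', hc'⟩ := Part.dom_iff_mem.1 h
  obtain ⟨hreach, hnone⟩ := mem_eval.1 hc'
  clear h hc'
  have hcons {c : TM0.Cfg Γ Λ} (hc : c.q ∈ S) {a' : Γ} {y : ℕ}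
      (hg : ∀ g ∈ (ν.rule M c.q c.Tape.head a').guards, g ⬝ᵥ ν.vec c y = 0)
      {rs : List (Rule (Fin 6))} (hrs : ∀ r ∈ rs, r ∈ ν.rules M)
      (hacc : Accepts 1 ((ν.rule M c.q c.Tape.head a').update *ᵥ ν.vec c y) rs) :
      ∃ rs : List (Rule (Fin 6)), (∀ r ∈ rs, r ∈ ν.rules M) ∧ Accepts 1 (ν.vec c 0) rs := by
    -- The register is `0` after every step of the machine, so `y` increments produce the required
    -- guess.
    refine ⟨List.replicate y incrRule ++ ν.rule M c.q c.Tape.head a' :: rs, fun r hr => ?_,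
      accepts_replicate_incrRule c 0 y _ (by rw [zero_add]; exact ⟨hg, hacc⟩)⟩
    rcases List.mem_append.1 hr with hr | hr
    · rw [List.eq_of_mem_replicate hr]
      exact List.mem_cons_self
    · rcases List.mem_cons.1 hr with rfl | hr
      · exact List.mem_cons_of_mem _
          (List.mem_map.2 ⟨(c.q, c.Tape.head, a'), by simpa using hc, rfl⟩)
      · exact hrs r hr
  induction hreach using Relation.ReflTransGen.head_induction_on with
  | refl =>
    obtain ⟨a', y, hg⟩ := ν.exists_guess (M := M) c'
    exact hcons hc hg (rs := []) (by simp) (Numbering.rule_halt (TM0_step_eq_none.1 hnone) _)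
  | @head c d hstep _ ih =>
    obtain ⟨a', y, hg⟩ := ν.exists_guess (M := M) c
    obtain ⟨rs, hrs, hacc⟩ := ih (TM0.step_supports M hS hstep hc)
    exact hcons hc hg hrs (by rwa [Numbering.rule_sound hstep hg])

theorem Numbering.exists_accepts_iff [Fintype Γ] {M : TM0.Machine Γ Λ}
    (hS : TM0.Supports M (S : Set Λ)) (l : List Γ) :
    (∃ rs : List (Rule (Fin 6)), (∀ r ∈ rs, r ∈ ν.rules M) ∧
      Accepts 1 (ν.vec (TM0.init l) 0) rs) ↔ (TM0.eval M l).Dom :=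
  ⟨fun ⟨rs, hrs, h⟩ => Numbering.dom_of_accepts hS rs hrs hS.1 h,
    fun h => Numbering.exists_accepts_of_dom hS hS.1 h⟩

end Turing

end MMG

namespace MMG

open Turing StateTransition

/-! ### Turing machines for partial recursive functions. -/

section Universal

instance : Fintype PartrecToTM2.K' :=
  ⟨{.main, .rev, .aux, .stack}, fun k => by cases k <;> decide⟩

lemma trNat_two_pow (k : ℕ) :
    PartrecToTM2.trNat (2 ^ k) =
      List.replicate k PartrecToTM2.Γ'.bit0 ++ [PartrecToTM2.Γ'.bit1] := by
  have h (k : ℕ) : ∃ p : PosNum, ((2 ^ k : ℕ) : Num) = Num.pos p ∧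
      PartrecToTM2.trPosNum p =
        List.replicate k PartrecToTM2.Γ'.bit0 ++ [PartrecToTM2.Γ'.bit1] := by
    induction k with
    | zero => exact ⟨PosNum.one, rfl, rfl⟩
    | succ k ih =>
      obtain ⟨p, hp, h⟩ := ih
      refine ⟨p.bit0, ?_, by simp [PartrecToTM2.trPosNum, h, List.replicate_succ]⟩
      have h2 : (2 ^ (k + 1) : ℕ) = 2 ^ k + 2 ^ k := by ring
      rw [h2, Nat.cast_add, hp]
      apply Num.to_nat_inj.1
      simp
  obtain ⟨p, hp, h⟩ := h k
  rw [PartrecToTM2.trNat, hp, PartrecToTM2.trNum, h]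

/-- A tape symbol of the simulation of a stack machine, with a symbol of the main stack only. -/
def mainSymbol (bottom : Bool) (a : PartrecToTM2.Γ') :
    TM2to1.Γ' PartrecToTM2.K' fun _ => PartrecToTM2.Γ' :=
  (bottom, Function.update (fun _ => none) PartrecToTM2.K'.main (some a))

/-- On the input `2 ^ k`, the initial tape depends on `k` only through the number of copies of one
symbol, so its number is given by a simple recursion. -/
lemma trInit_two_pow (k : ℕ) :
    TM2to1.trInit (Γ := fun _ => PartrecToTM2.Γ') PartrecToTM2.K'.main
      (PartrecToTM2.trList [2 ^ k]) =
    mainSymbol true .cons :: mainSymbol false .bit1 ::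
      List.replicate k (mainSymbol false .bit0) := by
  have hr : (PartrecToTM2.trList [2 ^ k]).reverse =
      .cons :: .bit1 :: List.replicate k PartrecToTM2.Γ'.bit0 := by
    simp [trNat_two_pow]
  unfold TM2to1.trInit
  rw [hr]
  exact congrArg (_ :: _ :: ·) List.map_replicate

/-- An unbounded search for the exponent recovers `k` from `2 ^ k`. -/
lemma partrec_of_two_pow {f : ℕ →. ℕ} (hf : Partrec f) :
    ∃ g : ℕ →. ℕ, Partrec g ∧ ∀ k, g (2 ^ k) = f k := by
  have hpow : Primrec₂ ((· ^ ·) : ℕ → ℕ → ℕ) := Primrec₂.unpaired'.1 Nat.Primrec.pow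
  have hp : Computable₂ fun m k : ℕ => decide (2 ^ k = m) :=
    (Primrec.eq.decide.comp (hpow.comp (Primrec.const 2) Primrec.snd) Primrec.fst).to_comp
  refine ⟨fun m => (Nat.rfind fun k => Part.some (decide (2 ^ k = m))).bind f,
    Partrec.bind (Partrec.rfind hp.partrec₂) (hf.comp Computable.snd), fun k => ?_⟩
  have : Nat.rfind (fun j => Part.some (decide (2 ^ j = 2 ^ k))) = Part.some k := by
    refine Part.eq_some_iff.2 (Nat.mem_rfind.2 ⟨by simp, fun {m} hm => ?_⟩)
    simp [(Nat.pow_lt_pow_right one_lt_two hm).ne]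
  exact (congrArg (fun p : Part ℕ => p.bind f) this).trans (Part.bind_some k f)

theorem exists_turing_machine {f : ℕ →. ℕ} (hf : Partrec f) :
    ∃ (Γ Λ : Type) (_ : Inhabited Γ) (_ : Fintype Γ) (_ : Inhabited Λ) (M : TM0.Machine Γ Λ)
      (S : Finset Λ), TM0.Supports M (S : Set Λ) ∧
      ∃ a b c : Γ, ∀ k, (TM0.eval M (a :: b :: List.replicate k c)).Dom ↔ (f k).Dom := by
  obtain ⟨g, hg, hgf⟩ := partrec_of_two_pow hf
  obtain ⟨C, hC⟩ := ToPartrec.Code.exists_code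
    (Nat.Partrec'.of_part (f := fun v : List.Vector ℕ 1 => g v.head)
      (hg.comp Computable.vector_head))
  -- The start state is `default`, so this instance makes the machine run the code `C`.
  let _ : Inhabited PartrecToTM2.Λ' := ⟨PartrecToTM2.trNormal C PartrecToTM2.Cont'.halt⟩
  have hS := TM1to0.tr_supports _ (TM2to1.tr_supports _
    (PartrecToTM2.tr_supports C PartrecToTM2.Cont'.halt))
  refine ⟨_, _, inferInstance, inferInstance, _, TM1to0.tr (TM2to1.tr PartrecToTM2.tr), _, hS,
    mainSymbol true .cons, mainSymbol false .bit1, mainSymbol false .bit0, fun k => ?_⟩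
  have hinit : TM2.init PartrecToTM2.K'.main (PartrecToTM2.trList [2 ^ k]) =
      PartrecToTM2.init C [2 ^ k] := by
    refine congrArg (TM2.Cfg.mk _ _) (funext fun k' => ?_)
    cases k' <;> rfl
  have hdom : (TM2.eval PartrecToTM2.tr PartrecToTM2.K'.main
      (PartrecToTM2.trList [2 ^ k])).Dom ↔ (f k).Dom := by
    rw [← hgf]
    change (eval (TM2.step PartrecToTM2.tr) (TM2.init _ _)).Dom ↔ _
    rw [hinit, PartrecToTM2.tr_eval, hC ⟨[2 ^ k], rfl⟩]
    rfl
  rw [← trInit_two_pow, ← hdom]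
  exact (iff_of_eq (congrArg Part.Dom (TM1to0.tr_eval _ _))).trans
    (TM2to1.tr_eval_dom PartrecToTM2.tr PartrecToTM2.K'.main _)

end Universal

end MMG

namespace MMG

open Matrix Turing

/-! ### The computable reduction from halting to values. -/

section Reduction

lemma primrec_intCast : Primrec (fun n : ℕ => (n : ℤ)) := by
  have h : Primrec fun n : ℕ => Encodable.encode (n : ℤ) :=
    -- Nonnegative integers `n` are encoded as `2 * n`.
    (Primrec.nat_mul.comp (Primrec.const 2) Primrec.id).of_eq fun n => rfl
  exact Primrec.encode_iff.1 h

/-- The dimension of the matrices of the reduction. -/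
abbrev dim : ℕ := Fintype.card (Fin 6 × Fin 6 ⊕ Unit)

/-- Renumbering of the coordinates. -/
noncomputable def renumber :
    Matrix (Fin 6 × Fin 6 ⊕ Unit) (Fin 6 × Fin 6 ⊕ Unit) ℤ ≃ₐ[ℤ] Matrix (Fin dim) (Fin dim) ℤ :=
  reindexAlgEquiv ℤ ℤ (Fintype.equivFin _)

/-- Each entry is a coefficient `0` or `1` times `0` or a product of two natural numbers, so
multiplication in `ℕ` suffices. -/
lemma primrec_matrixCode_restart (s : Fin 6) {x : ℕ → Fin 6 → ℕ} (hx : ∀ i, Primrec (x · i)) :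
    Primrec fun k => matrixCode (renumber (restart s fun i => (x k i : ℤ))) := by
  refine Primrec.list_ofFn fun i => Primrec.list_ofFn fun j => ?_
  generalize hi : (Fintype.equivFin (Fin 6 × Fin 6 ⊕ Unit)).symm i = i'
  generalize hj : (Fintype.equivFin (Fin 6 × Fin 6 ⊕ Unit)).symm j = j'
  have h (k : ℕ) : renumber (restart s fun i => (x k i : ℤ)) i j =
      restart s (fun i => (x k i : ℤ)) i' j' := by
    simp [renumber, hi, hj]
  have hv : finalForm s i' = 0 ∨ finalForm s i' = 1 := by
    rcases i' with p | p
    · rcases eq_or_ne p (s, s) with hp | hp <;> simp [finalForm, hp]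
    · simp [finalForm]
  have hu : Primrec fun k => squareVec (fun i => (x k i : ℤ)) 0 j' := by
    rcases j' with ⟨p, q⟩ | p
    · exact (primrec_intCast.comp (Primrec.nat_mul.comp (hx p) (hx q))).of_eq fun k => by
        simp [squareVec]
    · exact (Primrec.const 0).of_eq fun k => by simp [squareVec]
  rcases hv with hv | hv
  · exact (Primrec.const 0).of_eq fun k => by rw [h, restart, vecMulVec_apply, hv, zero_mul]
  · exact hu.of_eq fun k => by rw [h, restart, vecMulVec_apply, hv, one_mul]

theorem exists_reduction {f : ℕ →. ℕ} (hf : Partrec f) :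
    ∃ g : ℕ → Code, Computable g ∧ ∀ k, ∃ G : IntMMG, G.code = g k ∧
      ((f k).Dom → G.HasValue 0) ∧ (¬ (f k).Dom → G.HasValue 1) := by
  obtain ⟨Γ, Λ, _, _, _, M, S, hS, a, b, c, hM⟩ := exists_turing_machine hf
  obtain ⟨ν⟩ := nonempty_numbering (Γ := Γ) S
  -- `t k` is the number of the half tape of `k` copies of `c`, and `x k` is the initial
  -- configuration on input `k`.
  let t : ℕ → ℕ := fun k => Nat.rec 0 (fun _ n => ν.sym c + ν.base * n) k
  let x : ℕ → Fin 6 → ℕ := fun k => ![1, ν.state default, 0, ν.sym a, ν.sym b + ν.base * t k, 0]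
  have ht : Primrec t := Primrec.nat_rec₁ 0 (Primrec.nat_add.comp (Primrec.const _)
    (Primrec.nat_mul.comp (Primrec.const _) Primrec.snd))
  have hx : ∀ i, Primrec (x · i) := by
    intro i
    fin_cases i
    · exact Primrec.const _
    · exact Primrec.const _
    · exact Primrec.const _
    · exact Primrec.const _
    · exact Primrec.nat_add.comp (Primrec.const _) (Primrec.nat_mul.comp (Primrec.const _) ht)
    · exact Primrec.const _
  have hvec (k : ℕ) : (fun i => (x k i : ℤ)) =
      ν.vec (TM0.init (a :: b :: List.replicate k c)) 0 := by
    have htape : ν.tape (ListBlank.mk (b :: List.replicate k c)) = ν.sym b + ν.base * t k := by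
      rw [Numbering.tape, tapeNum_mk, List.foldr_cons]
      congr 2
      induction k with
      | zero => rfl
      | succ k ih => rw [List.replicate_succ, List.foldr_cons, ih]
    funext i
    fin_cases i
    · rfl
    · rfl
    · rfl
    · rfl
    · exact congrArg Nat.cast htape.symm
    · rfl
  let L : ℕ → List (Matrix (Fin dim) (Fin dim) ℤ) := fun k =>
    (restart 1 (fun i => (x k i : ℤ)) :: (ν.rules M).map Rule.matrix).map renumber
  have hmortal (k : ℕ) :
      (∃ l : List (Matrix (Fin dim) (Fin dim) ℤ), (∀ A ∈ l, A ∈ L k) ∧ l.prod = 0) ↔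
        (f k).Dom := by
    rw [← hM, ← Numbering.exists_accepts_iff (ν := ν) hS, ← hvec,
      ← exists_prod_eq_zero_iff (o := 0) (Numbering.rules_update_zero M) (by simp [x])]
    constructor
    · rintro ⟨l, hl, h0⟩
      refine ⟨l.map renumber.symm, fun A hA => ?_, ?_⟩
      · obtain ⟨B, hB, rfl⟩ := List.mem_map.1 hA
        obtain ⟨C, hC, rfl⟩ := List.mem_map.1 (hl B hB)
        rwa [AlgEquiv.symm_apply_apply]
      · rw [← map_list_prod, h0, map_zero]
    · rintro ⟨l, hl, h0⟩
      refine ⟨l.map renumber, fun A hA => ?_, by rw [← map_list_prod, h0, map_zero]⟩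
      obtain ⟨B, hB, rfl⟩ := List.mem_map.1 hA
      exact List.mem_map_of_mem (hl B hB)
  have hd : 0 < dim := Fintype.card_pos
  refine ⟨fun k => (soloGame hd (L k)).code, ?_, fun k => ⟨soloGame hd (L k), rfl, fun h => ?_,
    fun h => soloGame_hasValue_one hd _ fun l hl h0 => h ((hmortal k).1 ⟨l, hl, h0⟩)⟩⟩
  -- All matrices except the restart matrix are constants.
  · refine Primrec.to_comp ((Primrec.const (dim, dim)).pair ((Primrec.list_cons.comp
      (Primrec.const (matrixCode (1 : Matrix (Fin dim) (Fin dim) ℤ))) (Primrec.list_cons.comp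
      (primrec_matrixCode_restart 1 hx) (Primrec.const
        ((((ν.rules M).map Rule.matrix).map renumber).map matrixCode)))).pair
      (Primrec.const ([(1 : Matrix (Fin dim) (Fin dim) ℤ)].map matrixCode))))
  · obtain ⟨l, hl, h0⟩ := (hmortal k).2 h
    exact soloGame_hasValue_zero hd _ l hl h0

/-- Every game produced by the reduction satisfies the promise, so `f` is defined on all of their
codes, and testing its output with `p` decides halting. It is enough that `S` contains the games of
value `0` or `1`, so one argument serves all three claims. -/
theorem false_of_separates {S : Set IntMMG} (hS : ∀ G : IntMMG, G.HasValue 0 ∨ G.HasValue 1 → G ∈ S)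
    {f : Code →. ℤ} (hf : Partrec f) {p : ℤ → Prop} (hp : PrimrecPred p)
    (h0 : ∀ G ∈ S, G.HasValue 0 → ∃ z ∈ f G.code, p z)
    (h1 : ∀ G ∈ S, G.HasValue 1 → ∃ z ∈ f G.code, ¬ p z) : False := by
  classical
  have hU : Partrec fun n : ℕ =>
      (Denumerable.ofNat Nat.Partrec.Code n).eval 0 :=
    Nat.Partrec.Code.eval_part.comp (Computable.ofNat _) (Computable.const 0)
  obtain ⟨g, hg, hred⟩ := exists_reduction hU
  choose G hG hG0 hG1 using hred
  let halts (k : ℕ) : Prop := ((Denumerable.ofNat Nat.Partrec.Code k).eval 0).Dom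
  have key (k : ℕ) : ∃ z ∈ f (g k), (p z ↔ halts k) := by
    rw [← hG]
    by_cases hk : halts k
    · obtain ⟨z, hz, hpz⟩ := h0 _ (hS _ (Or.inl (hG0 k hk))) (hG0 k hk)
      exact ⟨z, hz, iff_of_true hpz hk⟩
    · obtain ⟨z, hz, hpz⟩ := h1 _ (hS _ (Or.inr (hG1 k hk))) (hG1 k hk)
      exact ⟨z, hz, iff_of_false hpz hk⟩
  choose z hz hpz using key
  have hzc : Computable z := (hf.comp hg).of_eq_tot hz
  have hdec : ComputablePred fun c : Nat.Partrec.Code => p (z (Encodable.encode c)) := by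
    obtain ⟨_, hp⟩ := hp
    exact ⟨inferInstance, (hp.to_comp.comp (hzc.comp Computable.encode)).of_eq fun c => rfl⟩
  refine ComputablePred.halting_problem 0 (hdec.of_eq fun c => ?_)
  rw [hpz]
  simp [halts]

theorem not_valueComputableOn {S : Set IntMMG}
    (hS : ∀ G : IntMMG, G.HasValue 0 ∨ G.HasValue 1 → G ∈ S) : ¬ ValueComputableOn S := by
  rintro ⟨f, hf, h⟩
  have hp : PrimrecPred fun z : ℤ => z = -1 ∨ z = 0 ∨ z = 1 :=
    (Primrec.eq.comp Primrec.id (Primrec.const _)).or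
      ((Primrec.eq.comp Primrec.id (Primrec.const _)).or
        (Primrec.eq.comp Primrec.id (Primrec.const _)))
  -- Precision `n = 2` gives `|z| ≤ 1` for value `0` and `z ≥ 3` for value `1`; with `n = 1`, the
  -- answer `z = 1` would be allowed for both.
  refine false_of_separates hS (f := fun c => f (c, 2))
    (hf.comp (Computable.id.pair (Computable.const 2))) hp (fun G hG hV => ?_) fun G hG hV => ?_
  · obtain ⟨z, hz, hle⟩ := h G hG 0 hV 2
    refine ⟨z, hz, ?_⟩
    rw [abs_le] at hle
    have h1 : (-1 : ℝ) ≤ z := by linarith [hle.2]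
    have h2 : (z : ℝ) ≤ 1 := by linarith [hle.1]
    have h1' : -1 ≤ z := by exact_mod_cast h1
    have h2' : z ≤ 1 := by exact_mod_cast h2
    omega
  · obtain ⟨z, hz, hle⟩ := h G hG 1 hV 2
    refine ⟨z, hz, ?_⟩
    rw [abs_le] at hle
    have h1 : (3 : ℝ) ≤ z := by linarith [hle.2]
    have h1' : 3 ≤ z := by exact_mod_cast h1
    omega

theorem not_valueExactlyComputableOn {S : Set IntMMG}
    (hS : ∀ G : IntMMG, G.HasValue 0 ∨ G.HasValue 1 → G ∈ S) : ¬ ValueExactlyComputableOn S := by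
  rintro ⟨f, hf, h⟩
  refine false_of_separates hS hf (p := fun z => z = 0)
    (Primrec.eq.comp Primrec.id (Primrec.const _)) (fun G hG hV => ?_) fun G hG hV => ?_
  · obtain ⟨z, hz, hV⟩ := h G hG 0 hV
    exact ⟨z, hz, by exact_mod_cast hV⟩
  · obtain ⟨z, hz, hV⟩ := h G hG 1 hV
    have : z = 1 := by exact_mod_cast hV
    exact ⟨z, hz, by omega⟩

end Reduction

end MMG

theorem mainTheorem7 :
    (¬ MMG.ValueComputableOn {G : MMG.IntMMG | G.Determined}) ∧
    (¬ MMG.ValueComputableOn {G : MMG.IntMMG | G.HasValue 0 ∨ G.HasValue 1}) ∧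
    (¬ MMG.ValueExactlyComputableOn {G : MMG.IntMMG | G.HasValue 0 ∨ G.HasValue 1}) :=
  ⟨MMG.not_valueComputableOn fun _ h => h.elim (fun h => ⟨0, h⟩) fun h => ⟨1, h⟩,
    MMG.not_valueComputableOn fun _ h => h, MMG.not_valueExactlyComputableOn fun _ h => h⟩
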